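/- Let $A$ be a commutative Noetherian ring of finite Krull dimension $d$, and let $\mathcal{D}^b(A)$ be the bounded derived category of the abelian category of finitely generated $A$-modules (complexes are indexed cohomologically). For $i=0,\dots,d$ let $\mathcal{D}^b_i(A)$ be the full triangulated subcategory of $\mathcal{D}^b(A)$ consisting of the complexes $X$ with $\dim H^n(X)\le i$ for all $n\in\mathbb{Z}$, where the dimension of a module is the Krull dimension of its support, and put $\mathcal{D}^b_{-1}(A)=0$. For $i=0,\dots,d$ let $\mathcal{C}_i(A)=\mathcal{D}^b_i(A)/\mathcal{D}^b_{i-1}(A)$ be the Verdier quotient, a triangulated category. Let $\mathcal{C}_i^{\le 0}$ (respectively $\mathcal{C}_i^{\ge 0}$) be the full subcategory of those objects of $\mathcal{C}_i(A)$ that are isomorphic in $\mathcal{C}_i(A)$ to the image of an object $Y$ of $\mathcal{D}^b_i(A)$ that is represented by a complex of finitely generated $A$-modules with $Y^n=0$ for all $n>0$ (respectively $Y^n=0$ for all $n<0$). Then for every $i=0,\dots,d$ the pair $(\mathcal{C}_i^{\le 0},\mathcal{C}_i^{\ge 0})$ is a bounded $t$-structure on $\mathcal{C}_i(A)$. That is,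 writing $[1]$ for the shift functor: 1. $\operatorname{Hom}_{\mathcal{C}_i(A)}(X,Y[-1])=0$ for all $X\in\mathcal{C}_i^{\le 0}$ and $Y\in\mathcal{C}_i^{\ge 0}$; 2. $\mathcal{C}_i^{\le 0}$ is closed under $[1]$ and $\mathcal{C}_i^{\ge 0}$ is closed under $[-1]$; 3. for each $X\in\mathcal{C}_i(A)$ there is an exact triangle $U\to X\to V[-1]\to U[1]$ with $U\in\mathcal{C}_i^{\le 0}$ and $V\in\mathcal{C}_i^{\ge 0}$; 4. for each $X\in\mathcal{C}_i(A)$ there are integers $m\le n$ with $X\in\mathcal{C}_i^{\le 0}[-n]\cap\mathcal{C}_i^{\ge 0}[-m]$. -/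

import Mathlib

universe w u

namespace DimFiltration

open CategoryTheory CategoryTheory.Limits CategoryTheory.Triangulated
  CategoryTheory.Pretriangulated

noncomputable section

section Modules

variable {A : Type u} [CommRing A]

/-- In an exact sequence `M → N → P`, if the outer terms have dimension at most `k`,
then so has the middle term. -/
lemma supportDim_le_of_exact {M N P : Type u} [AddCommGroup M] [Module A M]
    [AddCommGroup N] [Module A N] [AddCommGroup P] [Module A P]
    (f : M →ₗ[A] N) (g : N →ₗ[A] P) (h : Function.Exact f g) (k : WithBot ℕ∞)
    (hM : Module.supportDim A M ≤ k) (hP : Module.supportDim A P ≤ k) :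
    Module.supportDim A N ≤ k := by
  have key : Module.support A N ⊆ Module.support A M ∪ Module.support A P := by
    intro p hp
    by_contra hcon
    simp only [Set.mem_union, not_or] at hcon
    rw [Module.notMem_support_iff', Module.notMem_support_iff'] at hcon
    rw [Module.mem_support_iff'] at hp
    obtain ⟨n, hn⟩ := hp
    obtain ⟨r, hr, hr'⟩ := hcon.2 (g n)
    obtain ⟨m, hm⟩ := (h (r • n)).1 (by simpa using hr')
    obtain ⟨s, hs, hs'⟩ := hcon.1 m
    refine hn (s * r) (fun hmem => ?_) (by rw [mul_smul, ← hm, ← map_smul, hs', map_zero])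
    exact (p.isPrime.mem_or_mem hmem).elim hs hr
  have sub : ∀ {L : Type u} [AddCommGroup L] [Module A L] (s : LTSeries (Module.support A N)),
      s.head.1 ∈ Module.support A L → (s.length : WithBot ℕ∞) ≤ Module.supportDim A L := by
    intro L _ _ s hs
    have hmem : ∀ i, (s i).1 ∈ Module.support A L := fun i =>
      Module.mem_support_mono (s.head_le i) hs
    exact Order.LTSeries.length_le_krullDim
      (p := ({ length := s.length
               toFun := fun i => ⟨(s i).1, hmem i⟩
               step := fun i => s.step i } : LTSeries (Module.support A L)))
  refine iSup_le fun s => ?_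
  rcases key s.head.2 with h1 | h1
  · exact (sub s h1).trans hM
  · exact (sub s h1).trans hP

lemma supportDim_eq_of_iso {M N : FGModuleCat.{u} A} (e : M ≅ N) :
    Module.supportDim A M = Module.supportDim A N :=
  Module.supportDim_eq_of_equiv (FGModuleCat.isoToLinearEquiv e)

lemma supportDim_of_isZero {M : FGModuleCat.{u} A} (h : IsZero M) :
    Module.supportDim A M = ⊥ := by
  rw [Module.supportDim_eq_bot_iff_subsingleton]
  exact ModuleCat.subsingleton_of_isZero
    ((forget₂ (FGModuleCat.{u} A) (ModuleCat.{u} A)).map_isZero h)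

lemma isZero_of_supportDim {M : FGModuleCat.{u} A} (h : Module.supportDim A M = ⊥) :
    IsZero M := by
  rw [Module.supportDim_eq_bot_iff_subsingleton] at h
  rw [IsZero.iff_id_eq_zero]
  ext x
  exact Subsingleton.elim (α := M) _ _

end Modules

variable (A : Type u) [CommRing A] [IsNoetherianRing A]
  [HasDerivedCategory.{w} (FGModuleCat.{u} A)]

/-- The objects `X` of the derived category of finitely generated `A`-modules such that
`dim H^n(X) ≤ k` for all `n`. The dimension of a module is the Krull dimension of its support,
so the zero module has dimension `⊥`. -/
def dimLE (k : WithBot ℕ∞) : ObjectProperty (DerivedCategory (FGModuleCat.{u} A)) :=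
  fun X => ∀ n : ℤ, Module.supportDim A
    ((DerivedCategory.homologyFunctor (FGModuleCat.{u} A) n).obj X) ≤ k

instance (k : WithBot ℕ∞) : (dimLE.{w} A k).IsClosedUnderIsomorphisms where
  of_iso e h n := by
    rw [← supportDim_eq_of_iso ((DerivedCategory.homologyFunctor _ n).mapIso e)]
    exact h n

instance (k : WithBot ℕ∞) : (dimLE.{w} A k).ContainsZero where
  exists_zero := by
    obtain ⟨Z, hZ⟩ := HasZeroObject.zero (C := DerivedCategory (FGModuleCat.{u} A))
    refine ⟨Z, hZ, fun n => ?_⟩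
    rw [supportDim_of_isZero ((DerivedCategory.homologyFunctor _ n).map_isZero hZ)]
    exact bot_le

instance (k : WithBot ℕ∞) : (dimLE.{w} A k).IsStableUnderShift ℤ where
  isStableUnderShiftBy a := ⟨fun X hX n => by
    have e := ((DerivedCategory.homologyFunctor (FGModuleCat.{u} A) 0).shiftIso a n _ rfl).app X
    exact (supportDim_eq_of_iso e).trans_le (hX _)⟩

instance (k : WithBot ℕ∞) : (dimLE.{w} A k).IsTriangulatedClosed₂ :=
  .mk' fun T hT h₁ h₃ n => by
    have h := ((DerivedCategory.homologyFunctor (FGModuleCat.{u} A) n).map_distinguished_exact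
      T hT).map (forget₂ (FGModuleCat.{u} A) (ModuleCat.{u} A))
    rw [ShortComplex.ShortExact.moduleCat_exact_iff_function_exact] at h
    exact supportDim_le_of_exact _ _ h k (h₁ n) (h₃ n)

instance (k : WithBot ℕ∞) : (dimLE.{w} A k).IsTriangulated where

/-- `D^b(A)`: the bounded derived category of finitely generated `A`-modules. -/
abbrev Db : Type _ := DerivedCategory.Bounded (FGModuleCat.{u} A)

/-- The inclusion of `D^b(A)` in the unbounded derived category. -/
abbrev DbInc : Db.{w} A ⥤ DerivedCategory (FGModuleCat.{u} A) := DerivedCategory.Bounded.ι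

/-- The triangulated subcategory of `D^b(A)` of complexes whose cohomology modules all have
dimension at most `k`. -/
abbrev dbDimLE (k : WithBot ℕ∞) : ObjectProperty (Db.{w} A) :=
  (dimLE.{w} A k).inverseImage (DbInc.{w} A)

/-- The category `D^b_k(A)`, as a full subcategory of `D^b(A)`. -/
abbrev D (k : WithBot ℕ∞) : Type _ := (dbDimLE.{w} A k).FullSubcategory

/-- The predecessor of a dimension: `i - 1` for `i ≥ 1`, and `⊥` (the dimension of the zero
module) for `i = 0`. -/
def predDim : ℕ → WithBot ℕ∞
  | 0 => ⊥
  | i + 1 => (i : WithBot ℕ∞)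

/-- `D^b_{-1}(A) = 0`. -/
lemma dbDimLE_predDim_zero_iff (X : Db.{w} A) : dbDimLE.{w} A (predDim 0) X ↔ IsZero X := by
  constructor
  · intro h
    have hz : ∀ n : ℤ, IsZero ((DerivedCategory.homologyFunctor (FGModuleCat.{u} A) n).obj
        X.obj) := fun n => isZero_of_supportDim (le_bot_iff.1 (h n))
    have : IsZero X.obj := by
      have h₁ : X.obj.IsLE 0 := (DerivedCategory.isLE_iff _ _).2 fun i _ => hz i
      have h₂ : X.obj.IsGE 1 := (DerivedCategory.isGE_iff _ _).2 fun i _ => hz i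
      exact DerivedCategory.TStructure.t.isZero X.obj 0 1
    rw [IsZero.iff_id_eq_zero] at this ⊢
    exact (DbInc.{w} A).map_injective (by simpa using this)
  · intro h n
    rw [supportDim_of_isZero ((DerivedCategory.homologyFunctor _ n).map_isZero
      ((DbInc.{w} A).map_isZero h))]
    exact bot_le

/-- `D^b_{i-1}(A)`, as a triangulated subcategory of `D^b_i(A)`. -/
abbrev dPred (i : ℕ) : ObjectProperty (D.{w} A (i : WithBot ℕ∞)) :=
  (dbDimLE.{w} A (predDim i)).inverseImage (dbDimLE.{w} A (i : WithBot ℕ∞)).ι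

/-- The Verdier quotient `C_i(A) = D^b_i(A) / D^b_{i-1}(A)`: the localization of `D^b_i(A)` at the
morphisms whose cone lies in `D^b_{i-1}(A)`. -/
abbrev C (i : ℕ) : Type _ := (dPred.{w} A i).trW.Localization

instance (i : ℕ) (n : ℤ) : (shiftFunctor (C.{w} A i) n).Additive :=
  inferInstanceAs (shiftFunctor (dPred.{w} A i).trW.Localization n).Additive

instance (i : ℕ) : Pretriangulated (C.{w} A i) :=
  inferInstanceAs (Pretriangulated (dPred.{w} A i).trW.Localization)

instance (i : ℕ) : IsTriangulated (C.{w} A i) :=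
  inferInstanceAs (IsTriangulated (dPred.{w} A i).trW.Localization)

/-- The localization functor `D^b_i(A) ⥤ C_i(A)`. -/
abbrev toC (i : ℕ) : D.{w} A (i : WithBot ℕ∞) ⥤ C.{w} A i := (dPred.{w} A i).trW.Q

/-- The objects of `C_i(A)` which are isomorphic in `C_i(A)` to (the image of) a complex `K` in
`D^b_i(A)` with `K^n = 0` for all `n > 0`. -/
def cLE (i : ℕ) : ObjectProperty (C.{w} A i) := fun X =>
  ∃ (Y : D.{w} A (i : WithBot ℕ∞)) (K : CochainComplex (FGModuleCat.{u} A) ℤ),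
    Nonempty (Y.obj.obj ≅ DerivedCategory.Q.obj K) ∧ (∀ n : ℤ, 0 < n → IsZero (K.X n)) ∧
      Nonempty (X ≅ (toC.{w} A i).obj Y)

/-- The objects of `C_i(A)` which are isomorphic in `C_i(A)` to (the image of) a complex `K` in
`D^b_i(A)` with `K^n = 0` for all `n < 0`. -/
def cGE (i : ℕ) : ObjectProperty (C.{w} A i) := fun X =>
  ∃ (Y : D.{w} A (i : WithBot ℕ∞)) (K : CochainComplex (FGModuleCat.{u} A) ℤ),
    Nonempty (Y.obj.obj ≅ DerivedCategory.Q.obj K) ∧ (∀ n : ℤ, n < 0 → IsZero (K.X n)) ∧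
      Nonempty (X ≅ (toC.{w} A i).obj Y)

end
end DimFiltration

/-!
The standard t-structure of the derived category induces one on `D^b(A)`, and then one on each
`D^b_k(A)`, because the cohomology modules of a truncation of `X` are those of `X` in a range of
degrees and zero elsewhere. What remains is to push the t-structure of `D^b_i(A)` forward to
the Verdier quotient `C_i(A)`, the objects `≤ n` and `≥ n` being the images of such objects.

Shifts, truncation triangles and boundedness descend because the localization functor is
triangulated and essentially surjective. The only point is the vanishing of the morphisms from `X`
to `Y` in `C_i(A)` when `X ≤ 0` and `Y ≥ 1`. Such a morphism is a fraction `X ⟵ X' ⟶ Y` whose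
denominator has its cone in `D^b_{i-1}(A)`. By the long exact sequence of cohomology,
`dim H^n(X') < i` for `n > 0`, hence `τ≥1 X'` lies in `D^b_{i-1}(A)` and `X'` may be replaced by
`τ≤0 X'` (`exists_isLE_trW_dPred`). The numerator is then a morphism from an object `≤ 0` to an
object `≥ 1`, so it is zero. This last argument holds for any Verdier quotient in which denominators
can be refined in this way, see `CategoryTheory.Triangulated.TStructure.localization`.
-/

namespace CategoryTheory.Triangulated.TStructure

open Category Limits Pretriangulated

variable {C D : Type*} [Category* C] [Category* D] [Preadditive C] [Preadditive D]
  [HasZeroObject C] [HasZeroObject D] [HasShift C ℤ] [HasShift D ℤ]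
  [∀ n : ℤ, (shiftFunctor C n).Additive] [∀ n : ℤ, (shiftFunctor D n).Additive]
  [Pretriangulated C] [Pretriangulated D] [IsTriangulated C]

/-- The t-structure on the Verdier quotient of a triangulated category `C` by a triangulated
subcategory `P` (presented by an arbitrary localization functor `L : C ⥤ D`), for which an object
is `≤ n` or `≥ n` when it is isomorphic to the image of such an object of `C`.

The condition `hP` says that every fraction whose target is `≤ 0` can be refined to one whose
apex is `≤ 0`; it is what makes the vanishing of morphisms descend from `C` to `D`. -/
def localization (t : TStructure C) (P : ObjectProperty C) [P.IsTriangulated]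
    (L : C ⥤ D) [L.CommShift ℤ] [L.IsTriangulated] [L.IsLocalization P.trW]
    (hP : ∀ ⦃X' X : C⦄ (s : X' ⟶ X), P.trW s → t.le 0 X →
      ∃ (X'' : C) (u : X'' ⟶ X'), t.le 0 X'' ∧ P.trW (u ≫ s)) :
    TStructure D where
  le n := (t.le n).map L
  ge n := (t.ge n).map L
  le_shift n a n' h X := by
    rintro ⟨Y, hY, ⟨e⟩⟩
    exact ⟨Y⟦a⟧, t.le_shift n a n' h Y hY,
      ⟨(L.commShiftIso a).app Y ≪≫ (shiftFunctor D a).mapIso e⟩⟩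
  ge_shift n a n' h X := by
    rintro ⟨Y, hY, ⟨e⟩⟩
    exact ⟨Y⟦a⟧, t.ge_shift n a n' h Y hY,
      ⟨(L.commShiftIso a).app Y ≪≫ (shiftFunctor D a).mapIso e⟩⟩
  zero' := by
    rintro X Y f ⟨X₀, hX, ⟨eX⟩⟩ ⟨Y₀, hY, ⟨eY⟩⟩
    obtain ⟨φ, hφ⟩ := Localization.exists_rightFraction L P.trW (eX.hom ≫ f ≫ eY.inv)
    obtain ⟨X', u, hX', hu⟩ := hP φ.s φ.hs hX
    have := Localization.inverts L P.trW _ hu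
    -- on the refined fraction, the numerator goes from an object `≤ 0` to an object `≥ 1`
    have hzero : L.map (u ≫ φ.s) ≫ eX.hom ≫ f ≫ eY.inv = 0 := by
      rw [hφ, Functor.map_comp, assoc, MorphismProperty.RightFraction.map_s_comp_map,
        ← Functor.map_comp, t.zero' (u ≫ φ.f) hX' hY, Functor.map_zero]
    rw [← cancel_epi eX.hom, ← cancel_mono eY.inv, ← cancel_epi (L.map (u ≫ φ.s))]
    simpa using hzero
  le_zero_le := ObjectProperty.map_monotone t.le_zero_le L
  ge_one_le := ObjectProperty.map_monotone t.ge_one_le L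
  exists_triangle_zero_one A := by
    have := Localization.essSurj L P.trW
    let e := L.objObjPreimageIso A
    obtain ⟨X, Y, hX, hY, f, g, h, hT⟩ := t.exists_triangle_zero_one (L.objPreimage A)
    refine ⟨L.obj X, L.obj Y, ObjectProperty.prop_map_obj _ _ hX,
      ObjectProperty.prop_map_obj _ _ hY, L.map f ≫ e.hom, e.inv ≫ L.map g,
      L.map h ≫ (L.commShiftIso (1 : ℤ)).hom.app X,
      isomorphic_distinguished _ (L.map_distinguished _ hT) _ ?_⟩
    refine Triangle.isoMk _ _ (Iso.refl _) e.symm (Iso.refl _) ?_ ?_ ?_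
    · change (L.map f ≫ e.hom) ≫ e.inv = 𝟙 _ ≫ L.map f
      simp
    · change (e.inv ≫ L.map g) ≫ 𝟙 _ = e.inv ≫ L.map g
      simp
    · change (L.map h ≫ (L.commShiftIso (1 : ℤ)).hom.app X) ≫ (𝟙 (L.obj X))⟦(1 : ℤ)⟧' =
        𝟙 _ ≫ L.map h ≫ (L.commShiftIso (1 : ℤ)).hom.app X
      simp

end CategoryTheory.Triangulated.TStructure

namespace DimFiltration

open CategoryTheory CategoryTheory.Limits CategoryTheory.Triangulated
  CategoryTheory.Pretriangulated DerivedCategory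

lemma supportDim_le_of_shortComplex_exact {A : Type u} [CommRing A] [IsNoetherianRing A]
    {S : ShortComplex (FGModuleCat.{u} A)} (hS : S.Exact)
    (k : WithBot ℕ∞) (h₁ : Module.supportDim A S.X₁ ≤ k) (h₃ : Module.supportDim A S.X₃ ≤ k) :
    Module.supportDim A S.X₂ ≤ k := by
  have h := hS.map (forget₂ (FGModuleCat.{u} A) (ModuleCat.{u} A))
  rw [ShortComplex.ShortExact.moduleCat_exact_iff_function_exact] at h
  exact supportDim_le_of_exact _ _ h k h₁ h₃

variable {A : Type u} [CommRing A] [IsNoetherianRing A]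
  [HasDerivedCategory.{w} (FGModuleCat.{u} A)]

lemma supportDim_homology_obj₁_le {T : Triangle (DerivedCategory (FGModuleCat.{u} A))}
    (hT : T ∈ distTriang _) {k : WithBot ℕ∞} {n₀ n₁ : ℤ} (h : n₀ + 1 = n₁)
    (h₃ : Module.supportDim A ((homologyFunctor (FGModuleCat A) n₀).obj T.obj₃) ≤ k)
    (h₂ : Module.supportDim A ((homologyFunctor (FGModuleCat A) n₁).obj T.obj₂) ≤ k) :
    Module.supportDim A ((homologyFunctor (FGModuleCat A) n₁).obj T.obj₁) ≤ k :=
  supportDim_le_of_shortComplex_exact (HomologySequence.exact₁ T hT n₀ n₁ h) k h₃ h₂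

lemma supportDim_homology_obj₃_le {T : Triangle (DerivedCategory (FGModuleCat.{u} A))}
    (hT : T ∈ distTriang _) {k : WithBot ℕ∞} {n₀ n₁ : ℤ} (h : n₀ + 1 = n₁)
    (h₂ : Module.supportDim A ((homologyFunctor (FGModuleCat A) n₀).obj T.obj₂) ≤ k)
    (h₁ : Module.supportDim A ((homologyFunctor (FGModuleCat A) n₁).obj T.obj₁) ≤ k) :
    Module.supportDim A ((homologyFunctor (FGModuleCat A) n₀).obj T.obj₃) ≤ k :=
  supportDim_le_of_shortComplex_exact (HomologySequence.exact₃ T hT n₀ n₁ h) k h₂ h₁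

lemma supportDim_homology_le_of_isLE {X : DerivedCategory (FGModuleCat.{u} A)} {n i : ℤ}
    (hX : X.IsLE n) (hi : n < i) (k : WithBot ℕ∞) :
    Module.supportDim A ((homologyFunctor (FGModuleCat A) i).obj X) ≤ k := by
  rw [supportDim_of_isZero (X.isZero_of_isLE n i hi)]
  exact bot_le

lemma supportDim_homology_le_of_isGE {X : DerivedCategory (FGModuleCat.{u} A)} {n i : ℤ}
    (hX : X.IsGE n) (hi : i < n) (k : WithBot ℕ∞) :
    Module.supportDim A ((homologyFunctor (FGModuleCat A) i).obj X) ≤ k := by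
  rw [supportDim_of_isZero (X.isZero_of_isGE n i hi)]
  exact bot_le

/-- The truncation `τ≤0` preserves the condition `dim H^n ≤ k`: a triangle with outer terms `≤ 0`
and `≥ 1` is the truncation triangle of its middle term. -/
lemma dimLE_obj₁_of_isLE_of_isGE {T : Triangle (DerivedCategory (FGModuleCat.{u} A))}
    (hT : T ∈ distTriang _) (h₁ : T.obj₁.IsLE 0) (h₃ : T.obj₃.IsGE 1) {k : WithBot ℕ∞}
    (h₂ : dimLE.{w} A k T.obj₂) : dimLE.{w} A k T.obj₁ := fun n => by
  by_cases hn : 0 < n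
  · exact supportDim_homology_le_of_isLE h₁ hn k
  · exact supportDim_homology_obj₁_le hT (sub_add_cancel n 1)
      (supportDim_homology_le_of_isGE h₃ (by lia) k) (h₂ n)

/-- The truncation `τ≥1` of an object satisfies `dim H^n ≤ k` in all degrees as soon as the object
itself does in positive degrees. -/
lemma dimLE_obj₃_of_isLE_of_isGE {T : Triangle (DerivedCategory (FGModuleCat.{u} A))}
    (hT : T ∈ distTriang _) (h₁ : T.obj₁.IsLE 0) (h₃ : T.obj₃.IsGE 1) {k : WithBot ℕ∞}
    (h₂ : ∀ n : ℤ, 0 < n →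
      Module.supportDim A ((homologyFunctor (FGModuleCat A) n).obj T.obj₂) ≤ k) :
    dimLE.{w} A k T.obj₃ := fun n => by
  by_cases hn : 0 < n
  · exact supportDim_homology_obj₃_le hT rfl (h₂ n hn)
      (supportDim_homology_le_of_isLE h₁ (by lia) k)
  · exact supportDim_homology_le_of_isGE h₃ (by lia) k

instance (k : WithBot ℕ∞) :
    (dbDimLE.{w} A k).HasInducedTStructure (TStructure.t (C := FGModuleCat.{u} A)).onBounded where
  exists_triangle_zero_one X hX := by
    obtain ⟨U, V, hU, hV, f, g, h, hT⟩ :=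
      (TStructure.t (C := FGModuleCat.{u} A)).onBounded.exists_triangle_zero_one X
    have hT' := (DbInc.{w} A).map_distinguished _ hT
    have hU' := dimLE_obj₁_of_isLE_of_isGE hT' ⟨hU⟩ ⟨hV⟩ hX
    have hV' := dimLE_obj₃_of_isLE_of_isGE hT' ⟨hU⟩ ⟨hV⟩ (fun n _ => hX n)
    exact ⟨U, V, ⟨hU⟩, ⟨hV⟩, f, g, h, hT, ObjectProperty.le_isoClosure _ _ hU',
      ObjectProperty.le_isoClosure _ _ hV'⟩

variable (A) in
/-- The standard t-structure on `D^b_k(A)`. -/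
noncomputable abbrev tD (k : WithBot ℕ∞) : TStructure (D.{w} A k) :=
  (dbDimLE.{w} A k).tStructure (TStructure.t (C := FGModuleCat.{u} A)).onBounded

/-- A denominator `s : X' ⟶ X` with `X ≤ 0` can be replaced by `τ≤0 X' ⟶ X' ⟶ X`: as `H^n(X) = 0`
for `n > 0`, the module `H^n(X')` is then a quotient of `H^{n-1}` of the cone of `s`, so that the
cone `τ≥1 X'` of `τ≤0 X' ⟶ X'` lies in `D^b_{i-1}(A)`. -/
lemma exists_isLE_trW_dPred (i : ℕ) ⦃X' X : D.{w} A (i : WithBot ℕ∞)⦄ (s : X' ⟶ X)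
    (hs : (dPred.{w} A i).trW s) (hX : (tD.{w} A i).le 0 X) :
    ∃ (X'' : D.{w} A (i : WithBot ℕ∞)) (u : X'' ⟶ X'),
      (tD.{w} A i).le 0 X'' ∧ (dPred.{w} A i).trW (u ≫ s) := by
  obtain ⟨Z, a, b, hT, hZ⟩ := hs
  obtain ⟨U, V, hU, hV, f, g, h, hT'⟩ := (tD.{w} A i).exists_triangle_zero_one X'
  let F := (dbDimLE.{w} A (i : WithBot ℕ∞)).ι ⋙ DbInc.{w} A
  have hX' (n : ℤ) (hn : 0 < n) :
      Module.supportDim A ((homologyFunctor (FGModuleCat A) n).obj X'.obj.obj) ≤ predDim i :=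
    supportDim_homology_obj₁_le (F.map_distinguished _ hT) (sub_add_cancel n 1) (hZ (n - 1))
      (supportDim_homology_le_of_isLE ⟨hX⟩ hn _)
  have hV' : dPred.{w} A i V :=
    dimLE_obj₃_of_isLE_of_isGE (F.map_distinguished _ hT') ⟨hU⟩ ⟨hV⟩ hX'
  exact ⟨U, f, hU, (dPred.{w} A i).trW.comp_mem _ _ ⟨V, g, h, hT', hV'⟩ ⟨Z, a, b, hT, hZ⟩⟩

variable (A) in
/-- The t-structure on `C_i(A)` induced by the standard t-structure on `D^b_i(A)`. -/
noncomputable def tC (i : ℕ) : TStructure (C.{w} A i) :=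
  (tD.{w} A i).localization (dPred.{w} A i) (toC.{w} A i) (exists_isLE_trW_dPred i)

lemma tC_le_zero (i : ℕ) : (tC.{w} A i).le 0 = cLE.{w} A i := by
  ext X
  constructor
  · rintro ⟨Y, ⟨K, e, hK⟩, ⟨e'⟩⟩
    exact ⟨Y, K, ⟨e⟩, fun n hn => K.isZero_of_isStrictlyLE 0 n hn, ⟨e'.symm⟩⟩
  · rintro ⟨Y, K, ⟨e⟩, hK, ⟨e'⟩⟩
    exact ⟨Y, ⟨K, e, (K.isStrictlyLE_iff 0).2 hK⟩, ⟨e'.symm⟩⟩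

lemma tC_ge_zero (i : ℕ) : (tC.{w} A i).ge 0 = cGE.{w} A i := by
  ext X
  constructor
  · rintro ⟨Y, ⟨K, e, hK⟩, ⟨e'⟩⟩
    exact ⟨Y, K, ⟨e⟩, fun n hn => K.isZero_of_isStrictlyGE 0 n hn, ⟨e'.symm⟩⟩
  · rintro ⟨Y, K, ⟨e⟩, hK, ⟨e'⟩⟩
    exact ⟨Y, ⟨K, e, (K.isStrictlyGE_iff 0).2 hK⟩, ⟨e'.symm⟩⟩

/-- The t-structure on `C_i(A)` is bounded. -/
lemma exists_tC_le_tC_ge (i : ℕ) (X : C.{w} A i) :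
    ∃ m n : ℤ, m ≤ n ∧ (tC.{w} A i).le n X ∧ (tC.{w} A i).ge m X := by
  have := Localization.essSurj (toC.{w} A i) (dPred.{w} A i).trW
  let Y := (toC.{w} A i).objPreimage X
  obtain ⟨⟨a, ha⟩, ⟨b, hb⟩⟩ := Y.obj.property
  exact ⟨min a b, max a b, min_le_max,
    (tC.{w} A i).le_monotone (le_max_right a b) _ ⟨Y, hb.le, ⟨(toC.{w} A i).objObjPreimageIso X⟩⟩,
    (tC.{w} A i).ge_antitone (min_le_left a b) _ ⟨Y, ha.ge, ⟨(toC.{w} A i).objObjPreimageIso X⟩⟩⟩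

end DimFiltration

theorem mainTheorem1 (A : Type u) [CommRing A] [IsNoetherianRing A]
    [HasDerivedCategory.{w} (FGModuleCat.{u} A)] (d : ℕ) (hd : ringKrullDim A = d)
    (i : ℕ) (hi : i ≤ d) :
    ∃ t : CategoryTheory.Triangulated.TStructure (DimFiltration.C.{w} A i),
      t.le 0 = DimFiltration.cLE.{w} A i ∧ t.ge 0 = DimFiltration.cGE.{w} A i ∧
        ∀ X : DimFiltration.C.{w} A i, ∃ m n : ℤ, m ≤ n ∧ t.le n X ∧ t.ge m X :=
  ⟨DimFiltration.tC.{w} A i, DimFiltration.tC_le_zero i, DimFiltration.tC_ge_zero i,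
    DimFiltration.exists_tC_le_tC_ge i⟩
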